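/- Fix a finite alphabet $A$. A class $\mathcal C$ of languages over $A$ is a \emph{quotienting lattice of regular languages} if all its members are regular, $\emptyset, A^*\in\mathcal C$, and $\mathcal C$ is closed under union, intersection, and the quotients $u^{-1}L=\{w : uw\in L\}$ and $Lu^{-1}=\{w : wu\in L\}$ by words $u\in A^*$. Let $\mathrm{Pol}(\mathcal C)$ be the smallest class of languages containing $\mathcal C$ and closed under union and under marked concatenation $(H,L)\mapsto HaL$, $a\in A$, and let $\text{co-Pol}(\mathcal C)=\{L : A^*\setminus L\in \mathrm{Pol}(\mathcal C)\}$. A language $K$ \emph{separates} $L_1$ from $L_2$ if $L_1\subseteq K$ and $L_2\cap K=\emptyset$. Let $\alpha:A^*\to M$ be a surjective morphism onto a finite monoid. A pair $(s,t)\in M^2$ is a \emph{$\mathcal C$-pair} (for $\alpha$) if no $K\in\mathcal C$ separates $\alpha^{-1}(s)$ from $\alpha^{-1}(t)$; it is a \emph{saturated $\mathcal C$-pair} (for $\alpha$) if no $K\in\mathcal C$ of the form $K=\alpha^{-1}(F)$ with $F\subseteq M$ separates $\alpha^{-1}(s)$ from $\alpha^{-1}(t)$. For a regular language $L$, let $\alpha_L:A^*\to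 M_L$ be its syntactic morphism, that is, the quotient map onto the finite monoid $M_L=A^*/{\equiv_L}$, where $u\equiv_L v$ iff $xuy\in L\Leftrightarrow xvy\in L$ for all $x,y\in A^*$. Let $\omega\ge 1$ be the least positive integer such that $s^\omega$ is idempotent for all $s\in M_L$. \textbf{Theorem.} Let $\mathcal C$ be a quotienting lattice of regular languages over $A$. For every regular language $L\subseteq A^*$, the following are equivalent: \begin{enumerate} \item $L\in \mathrm{Pol}(\mathcal C)\cap\text{co-Pol}(\mathcal C)$; \item $s^{\omega+1}=s^\omega t s^\omega$ for all $\mathcal C$-pairs $(s,t)\in M_L^2$ for $\alpha_L$; \item $s^{\omega+1}=s^\omega t s^\omega$ for all saturated $\mathcal C$-pairs $(s,t)\in M_L^2$ for $\alpha_L$. \end{enumerate} Moreover, for every surjective morphism $\alpha:A^*\to M$ onto a finite monoid, the saturated $\mathcal C$-pair relation for $\alpha$ is the transitive closure of the $\mathcal C$-pair relation for $\alpha$. -/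

import Mathlib

namespace PolClosure

universe u v

section Classes

variable {A : Type u}

/-- The right quotient `L u⁻¹ = {w | w u ∈ L}`.  (The left quotient `u⁻¹ L = {w | u w ∈ L}` is
Mathlib's `Language.leftQuotient`.) -/
def rightQuotient (L : Language A) (u : List A) : Language A := {w | w ++ u ∈ L}

/-- A quotienting lattice of regular languages over `A`: a set of regular languages that contains
the empty language and the language of all words, and that is closed under union, intersection and
left and right quotients by words. -/
structure IsQuotientingLattice (𝒞 : Set (Language A)) : Prop where
  regular : ∀ L ∈ 𝒞, L.IsRegular
  empty_mem : (⊥ : Language A) ∈ 𝒞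
  univ_mem : (⊤ : Language A) ∈ 𝒞
  union_mem : ∀ K ∈ 𝒞, ∀ L ∈ 𝒞, K ⊔ L ∈ 𝒞
  inter_mem : ∀ K ∈ 𝒞, ∀ L ∈ 𝒞, K ⊓ L ∈ 𝒞
  leftQuotient_mem : ∀ L ∈ 𝒞, ∀ u : List A, L.leftQuotient u ∈ 𝒞
  rightQuotient_mem : ∀ L ∈ 𝒞, ∀ u : List A, rightQuotient L u ∈ 𝒞

/-- Membership in the polynomial closure: the least class that contains `𝒞` and is closed under
union and under marked concatenation `H, L ↦ H a L` with a letter `a`. -/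
inductive InPol (𝒞 : Set (Language A)) : Language A → Prop
  | base (L : Language A) : L ∈ 𝒞 → InPol 𝒞 L
  | union (H L : Language A) : InPol 𝒞 H → InPol 𝒞 L → InPol 𝒞 (H ⊔ L)
  | marked (H L : Language A) (a : A) : InPol 𝒞 H → InPol 𝒞 L → InPol 𝒞 (H * {[a]} * L)

/-- The class `Pol(𝒞)`. -/
def Pol (𝒞 : Set (Language A)) : Set (Language A) := {L | InPol 𝒞 L}

/-- The class `co-Pol(𝒞)` of the complements of the languages in `Pol(𝒞)`. -/
def coPol (𝒞 : Set (Language A)) : Set (Language A) := {L | Lᶜ ∈ Pol 𝒞}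

/-- `K` separates `L₁` from `L₂`. -/
def Separates (K L₁ L₂ : Language A) : Prop := L₁ ≤ K ∧ L₂ ⊓ K = ⊥

/-- `L₁` is `𝒞`-separable from `L₂`. -/
def Separable (𝒞 : Set (Language A)) (L₁ L₂ : Language A) : Prop := ∃ K ∈ 𝒞, Separates K L₁ L₂

variable {M : Type v} [Monoid M]

/-- The inverse image `α⁻¹(F)`, as a language. -/
def preimage (α : FreeMonoid A →* M) (F : Set M) : Language A :=
  {w : List A | α (FreeMonoid.ofList w) ∈ F}

/-- `L` is recognized by the morphism `α`. -/
def Recognizes (α : FreeMonoid A →* M) (L : Language A) : Prop := ∃ F : Set M, L = preimage α F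

/-- `(s, t)` is a `𝒞`-pair for `α`. -/
def IsPair (𝒞 : Set (Language A)) (α : FreeMonoid A →* M) (s t : M) : Prop :=
  ¬ Separable 𝒞 (preimage α {s}) (preimage α {t})

/-- `(s, t)` is a saturated `𝒞`-pair for `α`. -/
def IsSaturatedPair (𝒞 : Set (Language A)) (α : FreeMonoid A →* M) (s t : M) : Prop :=
  ¬ ∃ K ∈ 𝒞, Recognizes α K ∧ Separates K (preimage α {s}) (preimage α {t})

end Classes

section Omega

variable (M : Type v) [Monoid M]

/-- The number `ω(M)`: the least positive `n` such that `s ^ n` is idempotent for all `s : M`. It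
exists when `M` is finite, see `omega_spec`. -/
noncomputable def omega : ℕ := sInf {n : ℕ | 0 < n ∧ ∀ s : M, IsIdempotentElem (s ^ n)}

theorem omega_spec [Finite M] : 0 < omega M ∧ ∀ s : M, IsIdempotentElem (s ^ omega M) := by
  have key : ∀ s : M, ∃ n : ℕ, 0 < n ∧ IsIdempotentElem (s ^ n) := by
    intro s
    obtain ⟨i, j, hne, hij⟩ := Finite.exists_ne_map_eq_of_infinite (fun n : ℕ => s ^ n)
    wlog hlt : i < j generalizing i j
    · exact this j i hne.symm hij.symm (by omega)
    obtain ⟨p, rfl⟩ : ∃ p, j = i + p := ⟨j - i, by omega⟩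
    have hp : 0 < p := by omega
    have hstep : ∀ m k : ℕ, i ≤ m → s ^ (m + k * p) = s ^ m := by
      intro m k hm
      induction k with
      | zero => simp
      | succ k ih =>
        obtain ⟨d, rfl⟩ : ∃ d, m = i + d := ⟨m - i, by omega⟩
        have h1 : i + d + (k + 1) * p = (i + p) + (d + k * p) := by ring
        have hij' : s ^ i = s ^ (i + p) := hij
        rw [h1, pow_add s (i + p), ← hij', ← pow_add, ← add_assoc]
        exact ih
    refine ⟨(i + 1) * p, by positivity, ?_⟩
    have := hstep ((i + 1) * p) (i + 1) (by nlinarith)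
    rw [IsIdempotentElem, ← pow_add]
    exact this
  choose f hf hidem using key
  have := Fintype.ofFinite M
  refine Nat.sInf_mem (s := {n : ℕ | 0 < n ∧ ∀ s : M, IsIdempotentElem (s ^ n)}) ?_
  refine ⟨∏ s : M, f s, Finset.prod_pos fun s _ => hf s, fun s => ?_⟩
  obtain ⟨k, hk⟩ := Finset.dvd_prod_of_mem f (Finset.mem_univ s)
  rw [hk, pow_mul]
  exact (hidem s).pow k

end Omega

section Canonical

variable {A : Type u}

/-- The syntactic congruence of `L`: two words `u`, `v` are equivalent when
`x u y ∈ L ↔ x v y ∈ L` for all words `x`, `y`. -/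
def syntCon (L : Language A) : Con (FreeMonoid A) where
  r u v := ∀ x y : List A, x ++ u.toList ++ y ∈ L ↔ x ++ v.toList ++ y ∈ L
  iseqv :=
    ⟨fun _ _ _ => Iff.rfl, fun h x y => (h x y).symm, fun h h' x y => (h x y).trans (h' x y)⟩
  mul' := by
    intro u u' v v' hu hv x y
    have h1 := hu x (v.toList ++ y)
    have h2 := hv (x ++ u'.toList) y
    simp only [FreeMonoid.toList_mul, List.append_assoc] at h1 h2 ⊢
    exact h1.trans h2

/-- The syntactic monoid of `L`. -/
abbrev SyntMonoid (L : Language A) : Type u := (syntCon L).Quotient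

/-- The syntactic morphism of `L`, which maps a word to its class. -/
def syntHom (L : Language A) : FreeMonoid A →* SyntMonoid L := (syntCon L).mk'

/-- The syntactic monoid of a regular language is finite, so `omega_spec` applies to it. -/
theorem finite_syntMonoid {L : Language A} (hL : L.IsRegular) : Finite (SyntMonoid L) := by
  obtain ⟨σ, _, D, rfl⟩ := hL
  let f : FreeMonoid A → (σ → σ) := fun w q => D.evalFrom q w.toList
  have hf : ∀ u v : FreeMonoid A, f u = f v → syntCon D.accepts u v := by
    intro u v h x y
    have h' := congrFun h (D.eval x)
    simp only [f, DFA.eval] at h'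
    simp only [DFA.mem_accepts, DFA.eval, DFA.evalFrom_of_append, h']
  refine Finite.of_injective
    (fun s : SyntMonoid D.accepts => f (Function.surjInv Con.mk'_surjective s)) ?_
  intro s t hst
  have h := hf _ _ hst
  rw [← Function.surjInv_eq (Con.mk'_surjective (c := syntCon D.accepts)) s,
    ← Function.surjInv_eq (Con.mk'_surjective (c := syntCon D.accepts)) t]
  exact (Con.eq _).2 h

end Canonical

end PolClosure

/-! From Pol ∩ co-Pol to the equation: a language of Pol(𝒞) tests only finitely many languages of 𝒞.
Among many copies of `u`, one can therefore be replaced by any `v` lying in every tested language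
that contains `u` (`InPol.exists_replacement`). A pair (s, t) provides such `u`, `v` over s and t
(`exists_words_of_isPair`). Replacement in L and in its complement gives the two directions of the
syntactic equivalence of u^(ω+1) and u^ω v u^ω.

From the equation to Pol: each α⁻¹(m) lies in Pol(𝒞), by induction down the 𝒥-order. A word over m
is cut where its prefix, then the suffix of the rest, first falls to the 𝒥-class of m. The outer
pieces are strictly 𝒥-above m and are covered by induction. By stability and the equation
(`PairEquation.mul_mul_eq`), the middle matters only up to pairs, and these are controlled by one
language of 𝒞 (`exists_pair_neighborhood`). The argument covers every subset of the monoid, hence L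
and its complement.

Saturated pairs are the transitive closure of pairs, and the equation passes to that closure. -/

namespace PolClosure

universe u v

/-! ### Finite unions and intersections -/

section Lattice

variable {A : Type u} {𝒞 : Set (Language A)}

/-- A language that is covered by finitely many of its sublanguages in a class closed under finite
unions belongs to that class. -/
theorem mem_of_finite_cover {𝒟 : Set (Language A)} (hbot : ⊥ ∈ 𝒟)
    (hsup : ∀ K ∈ 𝒟, ∀ L ∈ 𝒟, K ⊔ L ∈ 𝒟) {ι : Type*} [Finite ι] (F : ι → Language A)
    (L : Language A) (h : ∀ w ∈ L, ∃ i, F i ∈ 𝒟 ∧ w ∈ F i ∧ F i ≤ L) : L ∈ 𝒟 := by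
  have hfin : {K | K ∈ Set.range F ∧ K ∈ 𝒟 ∧ K ≤ L}.Finite :=
    (Set.finite_range F).subset fun K hK => hK.1
  have hL : L = sSup {K | K ∈ Set.range F ∧ K ∈ 𝒟 ∧ K ≤ L} := by
    apply le_antisymm
    · intro w hw
      obtain ⟨i, h1, h2, h3⟩ := h w hw
      exact le_sSup (show F i ∈ {K | K ∈ Set.range F ∧ K ∈ 𝒟 ∧ K ≤ L} from ⟨⟨i, rfl⟩, h1, h3⟩) h2
    · exact sSup_le fun K hK => hK.2.2
  rw [hL]
  refine Set.Finite.induction_on_subset (motive := fun s _ => sSup s ∈ 𝒟) _ hfin ?_ ?_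
  · simpa using hbot
  · intro K s hK _ _ ih
    rw [sSup_insert]
    exact hsup _ hK.2.1 _ ih

theorem IsQuotientingLattice.sInf_mem (h𝒞 : IsQuotientingLattice 𝒞) {s : Set (Language A)}
    (hs : s.Finite) (hs' : s ⊆ 𝒞) : sInf s ∈ 𝒞 := by
  refine Set.Finite.induction_on_subset (motive := fun s _ => sInf s ∈ 𝒞) _ hs ?_ ?_
  · simpa using h𝒞.univ_mem
  · intro K s hK _ _ ih
    rw [sInf_insert]
    exact h𝒞.inter_mem _ (hs' hK) _ ih

theorem IsQuotientingLattice.bot_mem_pol (h𝒞 : IsQuotientingLattice 𝒞) : ⊥ ∈ Pol 𝒞 :=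
  InPol.base _ h𝒞.empty_mem

end Lattice

/-! ### Pairs, saturated pairs and transitive closure -/

section Pairs

variable {A : Type u} {𝒞 : Set (Language A)} {M : Type v} [Monoid M] {α : FreeMonoid A →* M}

theorem mem_preimage_iff (F : Set M) (w : List A) :
    w ∈ preimage α F ↔ α (FreeMonoid.ofList w) ∈ F := Iff.rfl

theorem separates_preimage_iff (K : Language A) (s t : M) :
    Separates K (preimage α {s}) (preimage α {t}) ↔
      (∀ w : FreeMonoid A, α w = s → w.toList ∈ K) ∧
        ∀ w : FreeMonoid A, α w = t → w.toList ∉ K := by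
  refine and_congr Iff.rfl ⟨fun h w hw hK => ?_, fun h => ?_⟩
  · have : w.toList ∈ preimage α {t} ⊓ K := ⟨hw, hK⟩
    rw [h] at this
    exact this
  · exact eq_bot_iff.2 fun w hw => h (FreeMonoid.ofList w) hw.1 hw.2

theorem isPair_iff (s t : M) : IsPair 𝒞 α s t ↔
    ∀ K ∈ 𝒞, (∀ w : FreeMonoid A, α w = s → w.toList ∈ K) →
      ∃ w : FreeMonoid A, α w = t ∧ w.toList ∈ K := by
  simp only [IsPair, Separable, separates_preimage_iff, not_exists, not_and, not_forall, not_not,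
    exists_prop]

theorem isPair_refl (hα : Function.Surjective α) (s : M) : IsPair 𝒞 α s s := by
  rw [isPair_iff]
  intro K _ h
  obtain ⟨w, hw⟩ := hα s
  exact ⟨w, hw, h w hw⟩

theorem IsPair.mul_left (h𝒞 : IsQuotientingLattice 𝒞) (hα : Function.Surjective α) {s t : M}
    (h : IsPair 𝒞 α s t) (x : M) : IsPair 𝒞 α (x * s) (x * t) := by
  rw [isPair_iff] at h ⊢
  intro K hK hs
  obtain ⟨z, rfl⟩ := hα x
  obtain ⟨w, hw, hwK⟩ := h _ (h𝒞.leftQuotient_mem K hK z.toList)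
    fun w hw => hs (z * w) (by rw [map_mul, hw])
  exact ⟨z * w, by rw [map_mul, hw], hwK⟩

theorem IsPair.mul_right (h𝒞 : IsQuotientingLattice 𝒞) (hα : Function.Surjective α) {s t : M}
    (h : IsPair 𝒞 α s t) (x : M) : IsPair 𝒞 α (s * x) (t * x) := by
  rw [isPair_iff] at h ⊢
  intro K hK hs
  obtain ⟨z, rfl⟩ := hα x
  obtain ⟨w, hw, hwK⟩ := h _ (h𝒞.rightQuotient_mem K hK z.toList)
    fun w hw => hs (w * z) (by rw [map_mul, hw])
  exact ⟨w * z, by rw [map_mul, hw], hwK⟩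

/-- There is a language of `𝒞` containing `α⁻¹(s)` whose words all have an image paired with
`s`. -/
theorem exists_pair_neighborhood (h𝒞 : IsQuotientingLattice 𝒞) [Finite M] (s : M) :
    ∃ K ∈ 𝒞, (∀ w : FreeMonoid A, α w = s → w.toList ∈ K) ∧
      ∀ w : FreeMonoid A, w.toList ∈ K → IsPair 𝒞 α s (α w) := by
  have h : ∀ t : M, ∃ K ∈ 𝒞, (∀ w : FreeMonoid A, α w = s → w.toList ∈ K) ∧
      ∀ w : FreeMonoid A, α w = t → w.toList ∈ K → IsPair 𝒞 α s t := by
    intro t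
    by_cases ht : IsPair 𝒞 α s t
    · exact ⟨⊤, h𝒞.univ_mem, fun _ _ => trivial, fun _ _ _ => ht⟩
    · obtain ⟨K, hK, hsep⟩ := not_not.1 ht
      rw [separates_preimage_iff] at hsep
      exact ⟨K, hK, hsep.1, fun w hw hwK => absurd hwK (hsep.2 w hw)⟩
  choose K hK hs hp using h
  -- Intersecting over the finitely many `t` excludes all non-paired images at once.
  refine ⟨sInf (Set.range K), h𝒞.sInf_mem (Set.finite_range K) ?_, ?_, ?_⟩
  · rintro _ ⟨t, rfl⟩
    exact hK t
  · rintro w hw _ ⟨t, rfl⟩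
    exact hs t w hw
  · intro w hw
    exact hp _ w rfl ((sInf_le ⟨α w, rfl⟩ : sInf (Set.range K) ≤ K (α w)) hw)

theorem isSaturatedPair_iff (hα : Function.Surjective α) (s t : M) :
    IsSaturatedPair 𝒞 α s t ↔ ∀ F : Set M, preimage α F ∈ 𝒞 → s ∈ F → t ∈ F := by
  constructor
  · intro h F hF hs
    by_contra ht
    refine h ⟨_, hF, ⟨F, rfl⟩, (separates_preimage_iff _ _ _).2 ⟨?_, ?_⟩⟩
    · rintro w rfl
      exact hs
    · rintro w rfl
      exact ht
  · rintro h ⟨_, hK, ⟨F, rfl⟩, hsep⟩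
    rw [separates_preimage_iff] at hsep
    obtain ⟨w, rfl⟩ := hα s
    obtain ⟨z, rfl⟩ := hα t
    exact hsep.2 z rfl (h F hK (hsep.1 w rfl))

/-- The elements reachable from `s` have a preimage in 𝒞, being a finite union of neighborhoods.
Conversely, a language of 𝒞 recognized by `α` has an accepting set closed under the pair relation.
-/
theorem isSaturatedPair_iff_transGen (h𝒞 : IsQuotientingLattice 𝒞) [Finite M]
    (hα : Function.Surjective α) (s t : M) :
    IsSaturatedPair 𝒞 α s t ↔ Relation.TransGen (IsPair 𝒞 α) s t := by
  rw [isSaturatedPair_iff hα]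
  constructor
  · intro h
    refine h {r | Relation.TransGen (IsPair 𝒞 α) s r} ?_ (.single (isPair_refl hα s))
    choose K hK hs hp using exists_pair_neighborhood (α := α) h𝒞
    refine mem_of_finite_cover h𝒞.empty_mem h𝒞.union_mem K _ fun w hw =>
      ⟨α (FreeMonoid.ofList w), hK _, hs _ (FreeMonoid.ofList w) rfl, fun z hz => ?_⟩
    exact Relation.TransGen.tail hw (hp _ (FreeMonoid.ofList z) hz)
  · intro h F hF hs
    have step : ∀ x y, IsPair 𝒞 α x y → x ∈ F → y ∈ F := by
      intro x y hxy hx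
      obtain ⟨w, rfl, hw⟩ := (isPair_iff x y).1 hxy _ hF (by rintro w rfl; exact hx)
      exact hw
    induction h with
    | single h => exact step _ _ h hs
    | tail _ h ih => exact step _ _ h ih

/-- The words lying above some word of α⁻¹(s), in the preorder defined by `𝒟`, form a finite union
of finite intersections from `𝒟`. This language of 𝒞 contains α⁻¹(s), so it meets α⁻¹(t). -/
theorem exists_words_of_isPair (h𝒞 : IsQuotientingLattice 𝒞) {𝒟 : Set (Language A)}
    (hfin : 𝒟.Finite) (hsub : 𝒟 ⊆ 𝒞) {s t : M} (h : IsPair 𝒞 α s t) :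
    ∃ x y : FreeMonoid A, α x = s ∧ α y = t ∧ ∀ K ∈ 𝒟, x.toList ∈ K → y.toList ∈ K := by
  by_contra hcon
  push Not at hcon
  let L : Language A := {w | ∃ x : FreeMonoid A, α x = s ∧ ∀ K ∈ 𝒟, x.toList ∈ K → w ∈ K}
  have hLmem : L ∈ 𝒞 := by
    have : Finite {E : Set (Language A) // E ⊆ 𝒟} := hfin.finite_subsets.to_subtype
    refine mem_of_finite_cover h𝒞.empty_mem h𝒞.union_mem
      (fun E : {E : Set (Language A) // E ⊆ 𝒟} => sInf E.1) L ?_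
    rintro w ⟨x, hx, hw⟩
    refine ⟨⟨{K | K ∈ 𝒟 ∧ x.toList ∈ K}, fun K hK => hK.1⟩,
      h𝒞.sInf_mem (hfin.subset fun K hK => hK.1) fun K hK => hsub hK.1, ?_, ?_⟩
    · rintro K ⟨hK, hxK⟩
      exact hw K hK hxK
    · intro z hz
      exact ⟨x, hx, fun K hK hxK => hz K ⟨hK, hxK⟩⟩
  obtain ⟨y, hy, x, hx, hxy⟩ := (isPair_iff s t).1 h L hLmem fun w hw => ⟨w, hw, fun _ _ h => h⟩
  obtain ⟨K, hK, hxK, hyK⟩ := hcon x y hx hy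
  exact hyK (hxy K hK hxK)

end Pairs

/-! ### Idempotent powers and stability -/

section Omega

variable {M : Type v} [Monoid M] [Finite M]

theorem isIdempotentElem_pow_omega (s : M) : IsIdempotentElem (s ^ omega M) := (omega_spec M).2 s

theorem pow_omega_mul {n : ℕ} (hn : 0 < n) (s : M) : s ^ (omega M * n) = s ^ omega M := by
  rw [pow_mul]
  exact (isIdempotentElem_pow_omega s).pow_eq hn.ne'

/-- Iterating the hypothesis gives p = x^ω p y^ω, and the idempotents are absorbed. -/
theorem eq_mul_pow_of_eq_mul_mul {p x y : M} (h : p = x * p * y) :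
    p * y ^ omega M = p ∧ x ^ omega M * p = p := by
  have key : ∀ n : ℕ, p = x ^ n * p * y ^ n := by
    intro n
    induction n with
    | zero => simp
    | succ n ih =>
      calc p = x ^ n * (x * p * y) * y ^ n := by rw [← h]; exact ih
        _ = x ^ (n + 1) * p * y ^ (n + 1) := by
          rw [pow_succ x, pow_succ' y]; simp only [mul_assoc]
  have h' := key (omega M)
  constructor
  · nth_rewrite 1 [h']
    rw [mul_assoc, (isIdempotentElem_pow_omega y).eq, ← h']
  · nth_rewrite 1 [h']
    rw [← mul_assoc, ← mul_assoc, (isIdempotentElem_pow_omega x).eq, ← h']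

/-- Stability of finite monoids, on the right. -/
theorem exists_eq_mul_right_of_eq_mul {p m x y : M} (h : p = x * (p * m) * y) :
    ∃ z, p = p * m * z := by
  obtain ⟨k, hk⟩ := Nat.exists_eq_succ_of_ne_zero (omega_spec M).1.ne'
  refine ⟨y * (m * y) ^ k, ?_⟩
  have := (eq_mul_pow_of_eq_mul_mul (p := p) (x := x) (y := m * y)
    (by simpa only [mul_assoc] using h)).1
  rw [hk, pow_succ'] at this
  simpa only [mul_assoc] using this.symm

/-- Stability of finite monoids, on the left. -/
theorem exists_eq_mul_left_of_eq_mul {p m x y : M} (h : p = x * (m * p) * y) :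
    ∃ z, p = z * (m * p) := by
  obtain ⟨k, hk⟩ := Nat.exists_eq_succ_of_ne_zero (omega_spec M).1.ne'
  refine ⟨(x * m) ^ k * x, ?_⟩
  have := (eq_mul_pow_of_eq_mul_mul (p := p) (x := x * m) (y := y)
    (by simpa only [mul_assoc] using h)).2
  rw [hk, pow_succ] at this
  simpa only [mul_assoc] using this.symm

end Omega

/-! ### Consequences of the equation -/

section Equation

variable {A : Type u} {𝒞 : Set (Language A)} {M : Type v} [Monoid M] [Finite M]
  {α : FreeMonoid A →* M}

/-- Every `𝒞`-pair satisfies the equation of the main theorem. -/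
def PairEquation (𝒞 : Set (Language A)) (α : FreeMonoid A →* M) : Prop :=
  ∀ s t : M, IsPair 𝒞 α s t → s ^ (omega M + 1) = s ^ omega M * t * s ^ omega M

/-- Multiplying a further pair (t, r) by s^ω on both sides turns its first entry into s^(ω+1), by
the equation already known for t. The ω-power of that entry is again s^ω, so the equation for the
new pair is the one for (s, r). -/
theorem PairEquation.transGen (h𝒞 : IsQuotientingLattice 𝒞) (hα : Function.Surjective α)
    (h : PairEquation 𝒞 α) {s t : M} (hst : Relation.TransGen (IsPair 𝒞 α) s t) :
    s ^ (omega M + 1) = s ^ omega M * t * s ^ omega M := by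
  induction hst with
  | single hst => exact h _ _ hst
  | @tail t r _ htr ih =>
    have hpair := (htr.mul_left h𝒞 hα (s ^ omega M)).mul_right h𝒞 hα (s ^ omega M)
    rw [← ih] at hpair
    have heq := h _ _ hpair
    have h1 : (s ^ (omega M + 1)) ^ omega M = s ^ omega M := by
      rw [← pow_mul, mul_comm, pow_omega_mul (Nat.succ_pos _)]
    have h2 := (isIdempotentElem_pow_omega s).eq
    rw [pow_succ, h1, pow_succ, ← mul_assoc, h2] at heq
    rw [pow_succ, heq]
    simp only [← mul_assoc, h2]
    rw [mul_assoc _ (s ^ omega M), h2]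

/-- If `p` and `r` are `𝒥`-equivalent to `p * s * r`, the factor `s` may be replaced in that product
by any `t` such that `(s, t)` is a pair. -/
theorem PairEquation.mul_mul_eq (h𝒞 : IsQuotientingLattice 𝒞) (hα : Function.Surjective α)
    (h : PairEquation 𝒞 α) {p s t r x y x' y' : M} (hp : p = x * (p * s * r) * y)
    (hr : r = x' * (p * s * r) * y') (hst : IsPair 𝒞 α s t) : p * t * r = p * s * r := by
  obtain ⟨z, hz⟩ := exists_eq_mul_right_of_eq_mul (m := s * r)
    (by simpa only [mul_assoc] using hp)
  obtain ⟨q, hq⟩ := exists_eq_mul_left_of_eq_mul (m := p * s) hr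
  -- Stability gave p = psrz and r = qpsr. Hence sqp is an idempotent fixing p on the right, and the
  -- equation is applied to the pair (sqp, tqp).
  have hpq : p * (s * q * p) = p :=
    calc p * (s * q * p) = p * s * q * (p * (s * r) * z) := by rw [← hz]; simp only [mul_assoc]
      _ = p * s * (q * (p * s * r)) * z := by simp only [mul_assoc]
      _ = p := by rw [← hq, mul_assoc p s r, ← hz]
  have hidem : IsIdempotentElem (s * q * p) := by
    rw [IsIdempotentElem, mul_assoc (s * q), hpq]
  have heq := h _ _ (hst.mul_right h𝒞 hα (q * p))
  rw [← mul_assoc, hidem.pow_eq (omega_spec M).1.ne', hidem.pow_eq (Nat.succ_ne_zero _)] at heq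
  calc p * t * r = p * (s * q * p) * t * (q * (p * s * r)) := by rw [hpq, ← hq]
    _ = p * (s * q * p) * t * (q * (p * (s * q * p) * s * r)) := by rw [hpq]
    _ = p * (s * q * p * (t * (q * p)) * (s * q * p)) * s * r := by simp only [mul_assoc]
    _ = p * s * r := by rw [← heq, hpq]

end Equation

/-! ### Cutting words at a letter -/

section Decomposition

variable {A : Type u}

theorem exists_first_prefix (P : List A → Prop) (h : ¬ P []) (w : List A) (hw : P w) :
    ∃ x a z, w = x ++ [a] ++ z ∧ ¬ P x ∧ P (x ++ [a]) := by
  induction w using List.reverseRecOn with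
  | nil => exact absurd hw h
  | append_singleton w a ih =>
    by_cases hPw : P w
    · obtain ⟨x, b, z, rfl, h1, h2⟩ := ih hPw
      exact ⟨x, b, z ++ [a], by simp, h1, h2⟩
    · exact ⟨w, a, [], by simp, hPw, hw⟩

theorem exists_last_suffix (P : List A → Prop) (h : ¬ P []) (w : List A) (hw : P w) :
    ∃ x a z, w = x ++ [a] ++ z ∧ ¬ P z ∧ P ([a] ++ z) := by
  induction w with
  | nil => exact absurd hw h
  | cons a w ih =>
    by_cases hPw : P w
    · obtain ⟨x, b, z, rfl, h1, h2⟩ := ih hPw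
      exact ⟨a :: x, b, z, by simp, h1, h2⟩
    · exact ⟨[], a, w, by simp, hPw, hw⟩

theorem mem_marked_iff (H L : Language A) (a : A) (w : List A) :
    w ∈ H * {[a]} * L ↔ ∃ x ∈ H, ∃ y ∈ L, w = x ++ [a] ++ y := by
  simp only [Language.mem_mul]
  constructor
  · rintro ⟨_, ⟨x, hx, _, rfl, rfl⟩, y, hy, rfl⟩
    exact ⟨x, hx, y, hy, rfl⟩
  · rintro ⟨x, hx, y, hy, rfl⟩
    exact ⟨x ++ [a], ⟨x, hx, [a], rfl, rfl⟩, y, hy, rfl⟩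

end Decomposition

/-! ### From the equation to polynomial closure -/

section PolOfEquation

variable {A : Type u} {𝒞 : Set (Language A)} {M : Type v} [Monoid M]

/-- `m` lies in the two-sided ideal generated by `n`. -/
def JLe (m n : M) : Prop := ∃ x y, m = x * n * y

theorem JLe.trans {l m n : M} (h : JLe l m) (h' : JLe m n) : JLe l n := by
  obtain ⟨x, y, rfl⟩ := h
  obtain ⟨x', y', rfl⟩ := h'
  exact ⟨x * x', y' * y, by simp only [mul_assoc]⟩

/-- The predecessors of `m` are the elements strictly 𝒥-above it, so induction starts from the class
of 1. -/
theorem wellFounded_jLe [Finite M] : WellFounded fun n m : M => JLe m n ∧ ¬ JLe n m := by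
  have : IsTrans M fun n m : M => JLe m n ∧ ¬ JLe n m :=
    ⟨fun _ _ _ h h' => ⟨h'.1.trans h.1, fun hc => h.2 (hc.trans h'.1)⟩⟩
  have : Std.Irrefl fun n m : M => JLe m n ∧ ¬ JLe n m := ⟨fun _ h => h.2 h.1⟩
  exact Finite.wellFounded_of_trans_of_irrefl _

variable [Finite M] {α : FreeMonoid A →* M}

theorem PairEquation.preimage_singleton_mem_pol [Finite A] (h𝒞 : IsQuotientingLattice 𝒞)
    (hα : Function.Surjective α) (h : PairEquation 𝒞 α) (m : M) :
    preimage α {m} ∈ Pol 𝒞 := by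
  induction m using (wellFounded_jLe (M := M)).induction with
  | _ m ih =>
  choose K hK hs hp using exists_pair_neighborhood (α := α) h𝒞
  have hword : ∀ w : List A, w ∈ preimage α {m} ↔ α (FreeMonoid.ofList w) = m := fun _ => Iff.rfl
  -- In the class of 1, replacement with trivial outer factors shows that only `m` is paired with
  -- `m`.
  by_cases h1 : JLe 1 m
  · refine InPol.base _ ?_
    obtain ⟨x, y, hxy⟩ := h1
    have : preimage α {m} = K m := by
      refine le_antisymm (fun w hw => hs _ (FreeMonoid.ofList w) hw) fun w hw => (hword w).2 ?_
      have := h.mul_mul_eq h𝒞 hα (p := 1) (r := 1) (x := x) (y := y) (x' := x) (y' := y)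
        (by simpa using hxy) (by simpa using hxy) (hp _ (FreeMonoid.ofList w) hw)
      simpa using this
    rw [this]
    exact hK m
  · let f : List A → M := fun w => α (FreeMonoid.ofList w)
    have hf : ∀ x y, f (x ++ y) = f x * f y := fun x y => map_mul α _ _
    have hf1 : f [] = 1 := map_one α
    let F : (M × A × M) ⊕ (M × A × M × A × M) → Language A := fun i => match i with
      | .inl (p, a, r) => preimage α {p} * {[a]} * preimage α {r}
      | .inr (p, a, s, b, r) => preimage α {p} * {[a]} * (K s * {[b]} * preimage α {r})
    -- The index type is finite because both `A` and `M` are.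
    refine mem_of_finite_cover h𝒞.bot_mem_pol (fun K hK L hL => InPol.union K L hK hL) F _ ?_
    intro w hw
    rw [hword] at hw
    obtain ⟨x, a, z, rfl, hx, hxa⟩ := exists_first_prefix (fun w => JLe (f w) m)
      (by simpa [hf1] using h1) w ⟨1, 1, by simpa using hw⟩
    have hw' : f x * f [a] * f z = m := by rw [← hf, ← hf]; exact hw
    have hxJ : JLe m (f x) := ⟨1, f [a] * f z, by rw [← hw']; simp only [mul_assoc, one_mul]⟩
    -- If f(z) is still strictly above m, a single marked letter suffices; otherwise a second cut
    -- isolates a middle factor `v`.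
    by_cases hz : JLe (f z) m
    · obtain ⟨v, b, y, rfl, hy, hby⟩ := exists_last_suffix (fun w => JLe (f w) m)
        (by simpa [hf1] using h1) z hz
      have hw'' : f (x ++ [a]) * f v * f ([b] ++ y) = m := by
        rw [← hw']; simp only [hf, mul_assoc]
      have hyJ : JLe m (f y) := ⟨f (x ++ [a]) * f v * f [b], 1, by
        rw [← hw'']; simp only [hf, mul_assoc, mul_one]⟩
      refine ⟨.inr (f x, a, f v, b, f y), ?_, ?_, ?_⟩
      · exact InPol.marked _ _ _ (ih _ ⟨hxJ, hx⟩)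
          (InPol.marked _ _ _ (InPol.base _ (hK _)) (ih _ ⟨hyJ, hy⟩))
      · refine (mem_marked_iff _ _ _ _).2 ⟨x, rfl, _, ?_, rfl⟩
        exact (mem_marked_iff _ _ _ _).2 ⟨v, hs _ (FreeMonoid.ofList v) rfl, y, rfl, rfl⟩
      · intro w hw
        obtain ⟨x', hx', z', hz', rfl⟩ := (mem_marked_iff _ _ _ _).1 hw
        obtain ⟨v', hv', y', hy', rfl⟩ := (mem_marked_iff _ _ _ _).1 hz'
        have hx' : f x' = f x := hx'
        have hy' : f y' = f y := hy'
        obtain ⟨c, d, hcd⟩ := hxa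
        obtain ⟨c', d', hcd'⟩ := hby
        have := h.mul_mul_eq h𝒞 hα (p := f (x ++ [a])) (s := f v) (r := f ([b] ++ y))
          (by rw [hw'']; exact hcd) (by rw [hw'']; exact hcd')
          (hp _ (FreeMonoid.ofList v') hv')
        refine (hword _).2 ?_
        rw [← hw'', ← this]
        change f _ = _ * f v' * _
        simp only [hf, hx', hy', mul_assoc]
    · have hzJ : JLe m (f z) := ⟨f x * f [a], 1, by rw [← hw', mul_one]⟩
      refine ⟨.inl (f x, a, f z), ?_, ?_, ?_⟩
      · exact InPol.marked _ _ _ (ih _ ⟨hxJ, hx⟩) (ih _ ⟨hzJ, hz⟩)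
      · exact (mem_marked_iff _ _ _ _).2 ⟨x, rfl, z, rfl, rfl⟩
      · intro w hw
        obtain ⟨x', hx', z', hz', rfl⟩ := (mem_marked_iff _ _ _ _).1 hw
        have hx' : f x' = f x := hx'
        have hz' : f z' = f z := hz'
        refine (hword _).2 ?_
        rw [← hw']
        change f _ = _
        simp only [hf, hx', hz']

theorem PairEquation.preimage_mem_pol [Finite A] (h𝒞 : IsQuotientingLattice 𝒞)
    (hα : Function.Surjective α) (h : PairEquation 𝒞 α) (F : Set M) :
    preimage α F ∈ Pol 𝒞 :=
  mem_of_finite_cover h𝒞.bot_mem_pol (fun K hK L hL => InPol.union K L hK hL)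
    (fun m => preimage α {m}) _ fun w hw =>
      ⟨α (FreeMonoid.ofList w), h.preimage_singleton_mem_pol h𝒞 hα _, rfl, fun z hz => by
        have hz : α (FreeMonoid.ofList z) = α (FreeMonoid.ofList w) := hz
        exact (mem_preimage_iff F z).2 (hz ▸ hw)⟩

end PolOfEquation

/-! ### Replacement inside languages of the polynomial closure -/

section Pumping

variable {A : Type u} {𝒞 : Set (Language A)}

/-- A two-sided quotient depends only on the syntactic classes of the two words. -/
theorem finite_range_quotients {L : Language A} (hL : L.IsRegular) :
    (Set.range fun p : List A × List A => rightQuotient (L.leftQuotient p.1) p.2).Finite := by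
  have := finite_syntMonoid hL
  let g : SyntMonoid L → List A := fun s =>
    (Function.surjInv (Con.mk'_surjective (c := syntCon L)) s).toList
  have hg : ∀ x : List A, syntCon L (FreeMonoid.ofList x)
      (FreeMonoid.ofList (g (syntHom L (FreeMonoid.ofList x)))) := fun x =>
    (Con.eq _).1 (Function.surjInv_eq (Con.mk'_surjective (c := syntCon L))
      (syntHom L (FreeMonoid.ofList x))).symm
  refine (Set.finite_range fun p : SyntMonoid L × SyntMonoid L =>
    rightQuotient (L.leftQuotient (g p.1)) (g p.2)).subset ?_
  rintro _ ⟨⟨x, y⟩, rfl⟩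
  refine ⟨(syntHom L (FreeMonoid.ofList x), syntHom L (FreeMonoid.ofList y)), ?_⟩
  ext w
  have h1 := hg x [] (w ++ y)
  have h2 := hg y (g (syntHom L (FreeMonoid.ofList x)) ++ w) []
  simp only [FreeMonoid.toList_ofList, List.nil_append, List.append_nil, List.append_assoc] at h1 h2
  exact (h1.trans h2).symm

theorem mul_eq_marked {x y w z : FreeMonoid A} {a : A} (h : x * y = w * FreeMonoid.of a * z) :
    (∃ x', x = w * FreeMonoid.of a * x' ∧ z = x' * y) ∨
      ∃ y', y = y' * FreeMonoid.of a * z ∧ w = x * y' := by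
  have h : x.toList ++ y.toList = w.toList ++ ([a] ++ z.toList) := by
    rw [← List.append_assoc]; exact h
  rcases List.append_eq_append_iff.1 h with ⟨c, hc1, hc2⟩ | ⟨c, hc1, hc2⟩
  · exact Or.inr ⟨FreeMonoid.ofList c, by rw [mul_assoc]; exact hc2, hc1⟩
  · cases c with
    | nil =>
      refine Or.inr ⟨1, ?_, ?_⟩
      · rw [one_mul]; exact hc2.symm
      · rw [mul_one]; simpa using hc1.symm
    | cons b c =>
      simp only [List.cons_append, List.nil_append, List.cons.injEq] at hc2
      obtain ⟨rfl, hc2⟩ := hc2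
      exact Or.inl ⟨FreeMonoid.ofList c, by rw [mul_assoc]; exact hc1, hc2⟩

theorem pow_eq_marked {u w z : FreeMonoid A} {a : A} {n : ℕ}
    (h : u ^ n = w * FreeMonoid.of a * z) :
    ∃ i j u' u'', i + j + 1 = n ∧ u = u' * FreeMonoid.of a * u'' ∧ w = u ^ i * u' ∧
      z = u'' * u ^ j := by
  induction n generalizing w with
  | zero =>
    have := congrArg FreeMonoid.length h
    simp only [pow_zero, FreeMonoid.length_one, FreeMonoid.length_mul, FreeMonoid.length_of] at this
    omega
  | succ n ih =>
    rw [pow_succ'] at h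
    rcases mul_eq_marked h with ⟨x', h1, h2⟩ | ⟨y', h1, h2⟩
    · exact ⟨0, n, w, x', by omega, h1, by simp, h2⟩
    · obtain ⟨i, j, u', u'', h3, h4, h5, h6⟩ := ih h1
      exact ⟨i + 1, j, u', u'', by omega, h4, by rw [h2, h5, pow_succ', mul_assoc], h6⟩

/-- Inside a language of `Pol(𝒞)`, a factor `u` surrounded by many copies of `u` may be replaced by
any word `v` that lies above `u` for a suitable finite part of `𝒞`. -/
theorem InPol.exists_replacement (h𝒞 : IsQuotientingLattice 𝒞) {p : ℕ} (hp : 0 < p)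
    {L : Language A} (hL : InPol 𝒞 L) :
    ∃ 𝒟 : Set (Language A), 𝒟.Finite ∧ 𝒟 ⊆ 𝒞 ∧ ∃ h : ℕ, ∀ n ≥ h, ∀ x y u v : FreeMonoid A,
      (∀ K ∈ 𝒟, u.toList ∈ K → v.toList ∈ K) → (x * u ^ (p * n + 1) * y).toList ∈ L →
      ∃ k l, 0 < k ∧ 0 < l ∧ (x * u ^ (p * k) * v * u ^ (p * l) * y).toList ∈ L := by
  induction hL with
  | base L hL =>
    -- The tested languages are all two-sided quotients of `L`. The threshold 2 leaves a positive
    -- exponent on each side of the replaced copy.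
    refine ⟨_, finite_range_quotients (h𝒞.regular L hL), ?_, 2, ?_⟩
    · rintro _ ⟨⟨x, y⟩, rfl⟩
      exact h𝒞.rightQuotient_mem _ (h𝒞.leftQuotient_mem _ hL _) _
    · intro n hn x y u v huv hmem
      obtain ⟨l, rfl⟩ := Nat.exists_eq_add_of_le' hn
      refine ⟨1, l + 1, one_pos, Nat.succ_pos _, ?_⟩
      have := huv _ ⟨((x * u ^ (p * 1)).toList, (u ^ (p * (l + 1)) * y).toList), rfl⟩ (by
        change (x * u ^ (p * 1) * (u * (u ^ (p * (l + 1)) * y))).toList ∈ L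
        convert hmem using 2
        rw [show p * (l + 2) + 1 = p * 1 + (1 + p * (l + 1)) by ring, pow_add, pow_add, pow_one]
        simp only [mul_assoc])
      change (x * u ^ (p * 1) * (v * (u ^ (p * (l + 1)) * y))).toList ∈ L at this
      simpa only [mul_assoc] using this
  | union H L _ _ ihH ihL =>
    obtain ⟨D, hD, hDC, h, hh⟩ := ihH
    obtain ⟨E, hE, hEC, g, hg⟩ := ihL
    refine ⟨D ∪ E, hD.union hE, Set.union_subset hDC hEC, h + g, ?_⟩
    intro n hn x y u v huv hmem
    rcases hmem with hmem | hmem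
    · obtain ⟨k, l, hk, hl, hkl⟩ := hh n (by omega) x y u v (fun K hK => huv K (.inl hK)) hmem
      exact ⟨k, l, hk, hl, .inl hkl⟩
    · obtain ⟨k, l, hk, hl, hkl⟩ := hg n (by omega) x y u v (fun K hK => huv K (.inr hK)) hmem
      exact ⟨k, l, hk, hl, .inr hkl⟩
  | marked H L a _ _ ihH ihL =>
    obtain ⟨D, hD, hDC, h, hh⟩ := ihH
    obtain ⟨E, hE, hEC, g, hg⟩ := ihL
    -- If the marked letter falls inside a copy of `u`, then i + j = pn full copies remain around
    -- it. This threshold forces i > ph or j > pg, enough to replace on one side.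
    refine ⟨D ∪ E, hD.union hE, Set.union_subset hDC hEC, h + g + 1, ?_⟩
    intro n hn x y u v huv hmem
    have hh := fun n hn x y => hh n hn x y u v fun K hK => huv K (.inl hK)
    have hg := fun n hn x y => hg n hn x y u v fun K hK => huv K (.inr hK)
    have hmark : ∀ w z : FreeMonoid A, w.toList ∈ H → z.toList ∈ L →
        (w * FreeMonoid.of a * z).toList ∈ H * {[a]} * L := fun w z hw hz =>
      (mem_marked_iff _ _ _ _).2 ⟨_, hw, _, hz, rfl⟩
    obtain ⟨w, hw, z, hz, hwz⟩ := (mem_marked_iff _ _ _ _).1 hmem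
    have hwz : x * u ^ (p * n + 1) * y =
      FreeMonoid.ofList w * FreeMonoid.of a * FreeMonoid.ofList z := hwz
    rcases mul_eq_marked hwz with ⟨z', h1, h2⟩ | ⟨y', h1, h2⟩
    · rcases mul_eq_marked h1 with ⟨x', h3, h4⟩ | ⟨w', h3, h4⟩
      · subst h4
        obtain ⟨k, l, hk, hl, hkl⟩ := hg n (by omega) x' y (by rw [← h2]; exact hz)
        refine ⟨k, l, hk, hl, ?_⟩
        convert hmark (FreeMonoid.ofList w) _ hw hkl using 2
        rw [h3]
        simp only [mul_assoc]
      · obtain ⟨i, j, u', u'', hij, h5, h6, h7⟩ := pow_eq_marked h3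
        have hw : (x * (u ^ i * u')).toList ∈ H := by rw [← h6, ← h4]; exact hw
        have hz : (u'' * u ^ j * y).toList ∈ L := by rw [← h7, ← h2]; exact hz
        have hij' : i + j = p * n := by omega
        have hpn : p * h + p * g + p ≤ p * n := by nlinarith
        rcases Nat.lt_or_ge (p * h) i with hi | hi
        · obtain ⟨d, rfl⟩ := Nat.exists_eq_add_of_lt hi
          obtain ⟨k, l, hk, hl, hkl⟩ := hh h le_rfl x (u ^ d * u') (by
            convert hw using 2
            rw [show p * h + d + 1 = p * h + 1 + d by ring, pow_add u (p * h + 1)]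
            simp only [mul_assoc])
          -- The d spare copies, the cut copy and the j right copies number exactly pn', so the
          -- exponent after `v` stays a multiple of p.
          obtain ⟨n', rfl⟩ : ∃ n', n = h + n' := ⟨n - h, by omega⟩
          refine ⟨k, l + n', hk, by omega, ?_⟩
          convert hmark _ _ hkl hz using 2
          have : p * (l + n') = p * l + (d + (1 + j)) := by
            rw [mul_add] at hij' ⊢; omega
          rw [this, pow_add, pow_add, pow_add, pow_one]
          nth_rewrite 4 [h5]
          simp only [mul_assoc]
        · have hj : p * g < j := by omega
          obtain ⟨d, rfl⟩ := Nat.exists_eq_add_of_lt hj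
          obtain ⟨k, l, hk, hl, hkl⟩ := hg g le_rfl (u'' * u ^ d) y (by
            convert hz using 2
            rw [show p * g + d + 1 = d + (p * g + 1) by ring, pow_add u d]
            simp only [mul_assoc])
          obtain ⟨n', rfl⟩ : ∃ n', n = g + n' := ⟨n - g, by omega⟩
          refine ⟨n' + k, l, by omega, hl, ?_⟩
          convert hmark _ _ hw hkl using 2
          have : p * (n' + k) = i + (1 + (d + p * k)) := by
            rw [mul_add] at hij' ⊢; omega
          rw [this, pow_add, pow_add, pow_add, pow_one]
          nth_rewrite 2 [h5]
          simp only [mul_assoc]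
    · obtain ⟨k, l, hk, hl, hkl⟩ := hh n (by omega) x y' (by rw [← h2]; exact hw)
      refine ⟨k, l, hk, hl, ?_⟩
      convert hmark _ (FreeMonoid.ofList z) hkl hz using 2
      rw [h1]
      simp only [mul_assoc]

end Pumping

/-! ### The syntactic morphism and both implications -/

section Syntactic

variable {A : Type u} {𝒞 : Set (Language A)}

theorem syntHom_surjective (L : Language A) : Function.Surjective (syntHom L) :=
  Con.mk'_surjective

theorem syntHom_eq_iff (L : Language A) (u v : FreeMonoid A) : syntHom L u = syntHom L v ↔
    ∀ x y : FreeMonoid A, (x * u * y).toList ∈ L ↔ (x * v * y).toList ∈ L :=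
  Con.eq _

theorem mem_congr_of_syntHom_eq {L : Language A} {u v : FreeMonoid A}
    (h : syntHom L u = syntHom L v) : u.toList ∈ L ↔ v.toList ∈ L := by
  simpa using (syntHom_eq_iff L u v).1 h 1 1

theorem recognizes_syntHom (L : Language A) : Recognizes (syntHom L) L := by
  refine ⟨syntHom L '' {w | w.toList ∈ L}, ?_⟩
  ext w
  constructor
  · exact fun hw => ⟨FreeMonoid.ofList w, hw, rfl⟩
  · rintro ⟨z, hz, h⟩
    exact (mem_congr_of_syntHom_eq h).1 hz

theorem pairEquation_syntHom (h𝒞 : IsQuotientingLattice 𝒞) {L : Language A} (hL : L.IsRegular)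
    (hmem : L ∈ Pol 𝒞) (hmem' : L ∈ coPol 𝒞) (s t : SyntMonoid L)
    (hst : IsPair 𝒞 (syntHom L) s t) :
    s ^ (omega (SyntMonoid L) + 1) =
      s ^ omega (SyntMonoid L) * t * s ^ omega (SyntMonoid L) := by
  have := finite_syntMonoid hL
  set p := omega (SyntMonoid L) with hpdef
  have hp : 0 < p := (omega_spec _).1
  obtain ⟨D, hD, hDC, h, hh⟩ := InPol.exists_replacement h𝒞 hp hmem
  obtain ⟨E, hE, hEC, g, hg⟩ := InPol.exists_replacement h𝒞 hp hmem'
  obtain ⟨u, v, rfl, rfl, huv⟩ :=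
    exists_words_of_isPair h𝒞 (hD.union hE) (Set.union_subset hDC hEC) hst
  have hpow : ∀ n, 0 < n → syntHom L u ^ (p * n) = syntHom L u ^ p := fun n hn =>
    pow_omega_mul hn _
  have hone : ∀ n, 0 < n → ∀ x y : FreeMonoid A,
      ((x * u ^ (p + 1) * y).toList ∈ L ↔ (x * u ^ (p * n + 1) * y).toList ∈ L) := by
    intro n hn x y
    apply mem_congr_of_syntHom_eq
    simp only [map_mul, map_pow, pow_succ, hpow n hn]
  have htwo : ∀ k l, 0 < k → 0 < l → ∀ x y : FreeMonoid A,
      ((x * (u ^ p * v * u ^ p) * y).toList ∈ L ↔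
        (x * u ^ (p * k) * v * u ^ (p * l) * y).toList ∈ L) := by
    intro k l hk hl x y
    apply mem_congr_of_syntHom_eq
    simp only [map_mul, map_pow, hpow k hk, hpow l hl, mul_assoc]
  simp only [← map_pow, ← map_mul]
  rw [syntHom_eq_iff]
  intro x y
  constructor
  · intro hxy
    -- Taking h + 1 rather than h keeps the multiple of ω positive, as needed to pass from u^(ω+1)
    -- to u^(ω(h+1)+1).
    obtain ⟨k, l, hk, hl, hkl⟩ := hh (h + 1) (by omega) x y u v
      (fun K hK => huv K (.inl hK)) ((hone _ (Nat.succ_pos _) x y).1 hxy)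
    exact (htwo k l hk hl x y).2 hkl
  · intro hxy
    by_contra hcon
    obtain ⟨k, l, hk, hl, hkl⟩ := hg (g + 1) (by omega) x y u v
      (fun K hK => huv K (.inr hK)) (fun hc => hcon ((hone _ (Nat.succ_pos _) x y).2 hc))
    exact hkl ((htwo k l hk hl x y).1 hxy)

theorem mem_pol_inter_coPol [Finite A] (h𝒞 : IsQuotientingLattice 𝒞) {L : Language A}
    [Finite (SyntMonoid L)] (h : PairEquation 𝒞 (syntHom L)) : L ∈ Pol 𝒞 ∩ coPol 𝒞 := by
  obtain ⟨F, hF⟩ := recognizes_syntHom L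
  constructor
  · rw [hF]
    exact h.preimage_mem_pol h𝒞 (syntHom_surjective L) F
  · have hc : Lᶜ = preimage (syntHom L) Fᶜ := by
      conv_lhs => rw [hF]
      rfl
    change Lᶜ ∈ Pol 𝒞
    rw [hc]
    exact h.preimage_mem_pol h𝒞 (syntHom_surjective L) Fᶜ

end Syntactic

end PolClosure

theorem mainTheorem3 {A : Type*} [Finite A] (𝒞 : Set (Language A))
    (h𝒞 : PolClosure.IsQuotientingLattice 𝒞) :
    (∀ L : Language A, L.IsRegular →
      List.TFAE [
        L ∈ PolClosure.Pol 𝒞 ∩ PolClosure.coPol 𝒞,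
        ∀ s t : PolClosure.SyntMonoid L,
          PolClosure.IsPair 𝒞 (PolClosure.syntHom L) s t →
            s ^ (PolClosure.omega (PolClosure.SyntMonoid L) + 1) =
              s ^ PolClosure.omega (PolClosure.SyntMonoid L) * t *
                s ^ PolClosure.omega (PolClosure.SyntMonoid L),
        ∀ s t : PolClosure.SyntMonoid L,
          PolClosure.IsSaturatedPair 𝒞 (PolClosure.syntHom L) s t →
            s ^ (PolClosure.omega (PolClosure.SyntMonoid L) + 1) =
              s ^ PolClosure.omega (PolClosure.SyntMonoid L) * t *
                s ^ PolClosure.omega (PolClosure.SyntMonoid L)]) ∧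
    (∀ (M : Type*) [Monoid M] [Finite M] (α : FreeMonoid A →* M), Function.Surjective α →
      ∀ s t : M, PolClosure.IsSaturatedPair 𝒞 α s t ↔
        Relation.TransGen (PolClosure.IsPair 𝒞 α) s t) := by
  refine ⟨fun L hL => ?_, fun M _ _ α hα s t =>
    PolClosure.isSaturatedPair_iff_transGen h𝒞 hα s t⟩
  have := PolClosure.finite_syntMonoid hL
  have hsurj := PolClosure.syntHom_surjective L
  tfae_have 1 → 2 := fun h s t => PolClosure.pairEquation_syntHom h𝒞 hL h.1 h.2 s t
  tfae_have 2 → 1 := fun h => PolClosure.mem_pol_inter_coPol h𝒞 h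
  tfae_have 2 → 3 := fun h s t hst =>
    PolClosure.PairEquation.transGen h𝒞 hsurj h
      ((PolClosure.isSaturatedPair_iff_transGen h𝒞 hsurj s t).1 hst)
  tfae_have 3 → 2 := fun h s t hst =>
    h s t ((PolClosure.isSaturatedPair_iff_transGen h𝒞 hsurj s t).2 (.single hst))
  tfae_finish
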